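/- Let $N$ be a finite set of $n$ voters and $A$ a non-empty finite set of $m$ alternatives. A preference profile $R$ assigns to each voter $i\in N$ a strict linear order $\succ_i$ on $A$; write $n_{xy}(R)=|\{i\in N: x\succ_i y\}|$. A social decision scheme (SDS) is a function $f$ that maps every preference profile $R$ to a probability distribution $f(R,\cdot)$ on $A$. An SDS $f$ is - strategyproof if for every voter $i$ and all profiles $R,R'$ that agree except possibly in the preferences of voter $i$, we have $\sum_{y:\,y\succ_i x} f(R,y)\ge \sum_{y:\,y\succ_i x} f(R',y)$ for every $x\in A$, where $\succ_i$ is the preference of voter $i$ in $R$; - anonymous if $f(R)=f(\pi(R))$ for all profiles $R$ and all permutations $\pi$ of $N$, where in $\pi(R)$ voter $\pi(i)$ has the preference that voter $i$ has in $R$; - neutral if $f(R,x)=f(\tau(R),\tau(x))$ for all profiles $R$, all $x\in A$ and all permutations $\tau$ of $A$, where in $\tau(R)$ each voter prefers $\tau(x)$ to $\tau(y)$ if and only if he prefers $x$ to $y$ in $R$; - $\alpha$-Condorcet-consistent, for $\alpha\in\mathbb{R}$, if $f(R,x)\ge\alpha$ for every profile $R$ and every Condorcet winner $x$ of $R$,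 i.e. every $x\in A$ with $n_{xy}(R)>n_{yx}(R)$ for all $y\in A\setminus\{x\}$. For $m\ge 2$, the randomized Copeland rule is the SDS that assigns to each $x\in A$ a probability proportional to its Copeland score $c(x,R)=|\{y\in A\setminus\{x\}: n_{xy}(R)>n_{yx}(R)\}|+\tfrac12|\{y\in A\setminus\{x\}: n_{xy}(R)=n_{yx}(R)\}|$. Theorem. Let $n\ge 3$. 1. If $m\ge 3$, then the randomized Copeland rule is strategyproof, anonymous, neutral and $\frac2m$-Condorcet-consistent, and it is the only SDS with these four properties. 2. For every $m\ge1$ and every real $\alpha>\frac2m$, no strategyproof SDS (anonymous and neutral or not) is $\alpha$-Condorcet-consistent. -/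

import Mathlib

namespace SocialChoice

/-- A preference relation on `A`: `r.pref x y` means that `x` is strictly preferred to `y`.
It is a strict linear order (asymmetry follows from irreflexivity and transitivity). -/
@[ext]
structure Preference (A : Type*) where
  pref : A → A → Prop
  irrefl : ∀ x, ¬ pref x x
  trans : ∀ x y z, pref x y → pref y z → pref x z
  complete : ∀ x y, x ≠ y → pref x y ∨ pref y x

/-- A preference profile assigns a preference relation to every voter. -/
abbrev Profile (N A : Type*) := N → Preference A

/-- A social decision scheme: a map from profiles to lotteries over the alternatives.
`f R x` is the probability of alternative `x` in the profile `R`. -/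
abbrev SDS (N A : Type*) [Fintype A] := Profile N A → stdSimplex ℝ A

open Classical in
/-- The number of voters who prefer `x` to `y`. -/
noncomputable def supportingSize {N A : Type*} [Fintype N] (R : Profile N A) (x y : A) : ℕ :=
  (Finset.univ.filter fun i => (R i).pref x y).card

/-- The profile `π(R)`, in which voter `π i` has the preference relation of voter `i` in `R`. -/
def Profile.permuteVoters {N A : Type*} (π : Equiv.Perm N) (R : Profile N A) : Profile N A :=
  fun i => R (π.symm i)

/-- The preference relation that ranks `τ x` over `τ y` if and only if `r` ranks `x` over `y`. -/
def Preference.permute {A : Type*} (τ : Equiv.Perm A) (r : Preference A) : Preference A where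
  pref x y := r.pref (τ.symm x) (τ.symm y)
  irrefl _ := r.irrefl _
  trans _ _ _ := r.trans _ _ _
  complete _ _ h := r.complete _ _ (fun e => h (τ.symm.injective e))

/-- The profile `τ(R)`, in which the alternatives are renamed according to `τ`. -/
def Profile.permuteAlternatives {N A : Type*} (τ : Equiv.Perm A) (R : Profile N A) : Profile N A :=
  fun i => (R i).permute τ

section Defs

variable {N A : Type*} [Fintype A]

/-- Anonymity. -/
def Anonymous (f : SDS N A) : Prop :=
  ∀ (R : Profile N A) (π : Equiv.Perm N), f R = f (Profile.permuteVoters π R)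

/-- Neutrality. -/
def Neutral (f : SDS N A) : Prop :=
  ∀ (R : Profile N A) (τ : Equiv.Perm A) (x : A),
    f R x = f (Profile.permuteAlternatives τ R) (τ x)

open Classical in
/-- (Weak) stochastic dominance: for every alternative `x`, the lottery `p` yields an alternative
strictly better than `x` with at least as much probability as `q`. -/
def StochDominates (r : Preference A) (p q : stdSimplex ℝ A) : Prop :=
  ∀ x : A, ∑ y with r.pref y x, q y ≤ ∑ y with r.pref y x, p y

/-- Strategyproofness with respect to stochastic dominance. -/
def Strategyproof (f : SDS N A) : Prop :=
  ∀ (R R' : Profile N A) (i : N), (∀ j, j ≠ i → R j = R' j) →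
    StochDominates (R i) (f R) (f R')

variable [Fintype N]

/-- `x` wins every majority comparison in `R`. -/
def IsCondorcetWinner {N A : Type*} [Fintype N] (R : Profile N A) (x : A) : Prop :=
  ∀ y, y ≠ x → supportingSize R y x < supportingSize R x y

/-- `α`-Condorcet-consistency: a Condorcet winner has probability at least `α`. -/
def CondorcetConsistent (α : ℝ) (f : SDS N A) : Prop :=
  ∀ (R : Profile N A) (x : A), IsCondorcetWinner R x → α ≤ f R x

open Classical in
/-- The Copeland score of `x`: the number of other alternatives that `x` beats in a majority
comparison, plus half the number of other alternatives with which `x` is tied. -/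
noncomputable def copelandScore (R : Profile N A) (x : A) : ℝ :=
  ((Finset.univ.filter fun y => y ≠ x ∧ supportingSize R y x < supportingSize R x y).card : ℝ)
    + (1 / 2) *
      ((Finset.univ.filter fun y => y ≠ x ∧ supportingSize R x y = supportingSize R y x).card : ℝ)

theorem copelandScore_nonneg (R : Profile N A) (x : A) : 0 ≤ copelandScore R x := by
  unfold copelandScore
  positivity

open Classical in
theorem copelandScore_eq_sum (R : Profile N A) (x : A) :
    copelandScore R x = ∑ y : A, if y ≠ x then
      (if supportingSize R y x < supportingSize R x y then (1 : ℝ)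
        else if supportingSize R x y = supportingSize R y x then 1 / 2 else 0) else 0 := by
  unfold copelandScore
  rw [Finset.card_filter, Finset.card_filter]
  push_cast
  rw [Finset.mul_sum, ← Finset.sum_add_distrib]
  refine Finset.sum_congr rfl fun y _ => ?_
  by_cases h : y = x
  · simp [h]
  · rcases lt_trichotomy (supportingSize R y x) (supportingSize R x y) with h1 | h1 | h1
    · simp [h, h1, h1.ne']
    · simp [h, h1]
    · simp [h, h1.not_gt, h1.ne]

/-- Each pair of alternatives contributes one point, so the Copeland scores sum to `m(m-1)/2`. -/
theorem sum_copelandScore (R : Profile N A) :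
    ∑ x, copelandScore R x = (Fintype.card A : ℝ) * ((Fintype.card A : ℝ) - 1) / 2 := by
  classical
  have key : ∑ x, copelandScore R x + ∑ x, copelandScore R x
      = ∑ x : A, ∑ y : A, if y ≠ x then (1 : ℝ) else 0 := by
    simp only [copelandScore_eq_sum]
    nth_rewrite 2 [Finset.sum_comm]
    rw [← Finset.sum_add_distrib]
    refine Finset.sum_congr rfl fun x _ => ?_
    rw [← Finset.sum_add_distrib]
    refine Finset.sum_congr rfl fun y _ => ?_
    by_cases h : y = x
    · simp [h]
    · rcases lt_trichotomy (supportingSize R y x) (supportingSize R x y) with h1 | h1 | h1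
      · simp [h, Ne.symm h, h1, h1.not_gt, h1.ne]
      · simp [h, Ne.symm h, h1]; norm_num
      · simp [h, Ne.symm h, h1, h1.not_gt, h1.ne]
  have h2 : ∀ x : A, (∑ y : A, if y ≠ x then (1 : ℝ) else 0) = (Fintype.card A : ℝ) - 1 := by
    intro x
    have : ∀ y : A, (if y ≠ x then (1 : ℝ) else 0) = 1 - if y = x then 1 else 0 := by
      intro y; by_cases h : y = x <;> simp [h]
    simp [this]
  simp only [h2, Finset.sum_const, Finset.card_univ, nsmul_eq_mul] at key
  linarith

theorem sum_copelandScore_pos (hm : 2 ≤ Fintype.card A) (R : Profile N A) :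
    0 < ∑ x, copelandScore R x := by
  have h : (2 : ℝ) ≤ Fintype.card A := by exact_mod_cast hm
  rw [sum_copelandScore]
  have : (0 : ℝ) < (Fintype.card A : ℝ) - 1 := by linarith
  positivity

/-- The randomized Copeland rule: the probabilities are proportional to the Copeland scores.
At least two alternatives are needed for the scores not to be all zero. -/
noncomputable def randomizedCopeland (hm : 2 ≤ Fintype.card A) : SDS N A := fun R =>
  ⟨fun x => copelandScore R x / ∑ y, copelandScore R y,
    fun x => div_nonneg (copelandScore_nonneg R x) (sum_copelandScore_pos hm R).le,
    by rw [← Finset.sum_div, div_self (sum_copelandScore_pos hm R).ne']⟩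

end Defs

end SocialChoice

/-! Under strategyproofness the probability of `x` depends only on the upper contour sets of `x`
(`Strategyproof.eq_of_upper_eq`), and swapping adjacent `x`, `y` moves probability only between
these two (`Strategyproof.add_eq_of_swap`). What `x` gains by passing `y` is thus lost by `y`, and
the other voters matter only through their opinion on the pair (`Strategyproof.gain_eq`). With
anonymity and neutrality the gain becomes a number `D s k`, for the rank `s` reached and the number
`k` of previous supporters of `x` against `y`. Doing two lifts in either order shows that `D` is a
function of `s` plus a function of `k`, and summing gains yields `exists_decomposition`: the
probability of `x` is a sum of weights `a` of its ranks plus a sum of weights `b` of its supporting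
sizes.

Let `T` be the sum of `a` over all ranks and `B = b n`. Total probability one reads `n T + m (m - 1)
B / 2 = 1`. If `T > 0`, some narrow Condorcet winner has ranks worth less than `2 n T / m`, and its
`b` part is at most `(m - 1) B`, so its probability is below `2 / m`. If `T = 0`, the bound is `(m -
1) B = 2 / m`, and attaining it forces `b` to equal `B` from the smallest majority on; by symmetry
`b` is then `B / 2` at ties and `0` below, which is the randomized Copeland rule.

Averaging over all renamings (`symmetrize`) extends the bound to rules that are not anonymous or
neutral. -/

namespace SocialChoice

open Finset Function
open scoped Classical

/-! ### Preferences with prescribed upper contour sets -/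

section Preferences

variable {N A : Type*} [Fintype A]

/-- The preference relation ranking alternatives by increasing value of an injective key. -/
def Preference.ofKey {α : Type*} [LinearOrder α] (k : A → α) (hk : Injective k) :
    Preference A where
  pref x y := k x < k y
  irrefl _ := lt_irrefl _
  trans _ _ _ := lt_trans
  complete _ _ h := lt_or_gt_of_ne (hk.ne h)

theorem Preference.asymm {A : Type*} (r : Preference A) {x y : A} (h : r.pref x y) : ¬ r.pref y x :=
  fun h' => r.irrefl _ (r.trans _ _ _ h h')

theorem Preference.not_pref_iff {A : Type*} (r : Preference A) {x y : A} (h : x ≠ y) :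
    ¬ r.pref x y ↔ r.pref y x :=
  ⟨fun h' => (r.complete x y h).resolve_left h', fun h' => r.asymm h'⟩

/-- Every weak ranking by levels is refined by a preference relation. -/
theorem exists_preference_of_level (c : A → ℕ) :
    ∃ r : Preference A, ∀ x y, c x < c y → r.pref x y := by
  refine ⟨Preference.ofKey (fun x => toLex (c x, Fintype.equivFin A x)) ?_, ?_⟩
  · intro x y h
    have := congrArg (fun z => (ofLex z).2) h
    exact (Fintype.equivFin A).injective this
  · intro x y h
    exact Prod.Lex.toLex_lt_toLex.2 (Or.inl h)

/-- The strict upper contour set of `x`. -/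
noncomputable def Preference.upper (r : Preference A) (x : A) : Finset A :=
  univ.filter fun y => r.pref y x

@[simp]
theorem Preference.mem_upper {r : Preference A} {x y : A} : y ∈ r.upper x ↔ r.pref y x := by
  simp [Preference.upper]

theorem Preference.self_notMem_upper (r : Preference A) (x : A) : x ∉ r.upper x := by
  simp [r.irrefl]

/-- Only comparisons of levels with that of `x` matter, so ties among the other alternatives may be
broken arbitrarily. -/
theorem Preference.upper_eq_of_level {r : Preference A} {c : A → ℕ}
    (h : ∀ x y, c x < c y → r.pref x y) {x : A} {S : Finset A}
    (hS : ∀ z, z ≠ x → (z ∈ S ∧ c z < c x) ∨ (z ∉ S ∧ c x < c z)) (hx : x ∉ S) :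
    r.upper x = S := by
  ext z
  rw [Preference.mem_upper]
  by_cases hz : z = x
  · subst hz; simp [r.irrefl, hx]
  · rcases hS z hz with ⟨h1, h2⟩ | ⟨h1, h2⟩
    · simp [h1, h _ _ h2]
    · simp [h1, r.asymm (h _ _ h2)]

theorem exists_upper_eq {x : A} {S : Finset A} (hx : x ∉ S) :
    ∃ r : Preference A, r.upper x = S := by
  obtain ⟨r, hr⟩ := exists_preference_of_level
    (fun z : A => if z ∈ S then 0 else if z = x then 1 else 2)
  refine ⟨r, Preference.upper_eq_of_level hr (fun z hz => ?_) hx⟩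
  by_cases h : z ∈ S <;> simp [h, hx, hz]

theorem exists_upper_eq_pair {x y : A} {S : Finset A} (hxy : x ≠ y) (hx : x ∉ S) (hy : y ∉ S) :
    ∃ r : Preference A, r.upper x = S ∧ r.upper y = insert x S := by
  obtain ⟨r, hr⟩ := exists_preference_of_level
    (fun z : A => if z ∈ S then 0 else if z = x then 1 else if z = y then 2 else 3)
  refine ⟨r, Preference.upper_eq_of_level hr (fun z hz => ?_) hx,
    Preference.upper_eq_of_level hr (fun z hz => ?_) (by simp [hy, hxy.symm])⟩
  · by_cases h : z ∈ S
    · simp [h, hx]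
    · by_cases h' : z = y
      · subst h'; simp [hx, hy, hz]
      · simp [h, hx, hz, h']
  · by_cases h : z ∈ S
    · simp [h, hy, hxy.symm]
    · by_cases h' : z = x
      · subst h'; simp [hx, hy, hxy.symm]
      · simp [h, hy, hz, h', hxy.symm]

/-- Moving `y` to the top or to the bottom without changing the upper contour set of `x`. -/
theorem exists_move_extreme (r : Preference A) {x y : A} (hxy : x ≠ y) :
    ∃ q : Preference A, q.upper x = r.upper x ∧
      q.upper y = if r.pref x y then univ.erase y else ∅ := by
  by_cases h : r.pref x y
  · obtain ⟨q, hq⟩ := exists_preference_of_level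
      (fun z : A => if z = y then 3 else if r.pref z x then 0 else if z = x then 1 else 2)
    have h' := r.asymm h
    refine ⟨q, Preference.upper_eq_of_level hq (fun z hz => ?_) (r.self_notMem_upper x),
      Preference.upper_eq_of_level hq (fun z hz => ?_) (by simp [h])⟩
    · by_cases h1 : z = y
      · subst h1; simp [h', hxy, r.irrefl]
      · by_cases h2 : r.pref z x <;> simp [h1, h2, hxy, hz, r.irrefl]
    · by_cases h2 : r.pref z x
      · simp [h, hz, h2]
      · by_cases h3 : z = x
        · subst h3; simp [h, hz, r.irrefl]
        · simp [h, hz, h2, h3]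
  · obtain ⟨q, hq⟩ := exists_preference_of_level
      (fun z : A => if z = y then 0 else if r.pref z x then 1 else if z = x then 2 else 3)
    have h' := (r.not_pref_iff hxy).1 h
    refine ⟨q, Preference.upper_eq_of_level hq (fun z hz => ?_) (r.self_notMem_upper x),
      Preference.upper_eq_of_level hq (fun z hz => ?_) (by simp [h])⟩
    · by_cases h1 : z = y
      · subst h1; simp [h', hxy, r.irrefl]
      · by_cases h2 : r.pref z x <;> simp [h1, h2, hxy, hz, r.irrefl]
    · by_cases h2 : r.pref z x
      · simp [h, hz, h2]
      · by_cases h3 : z = x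
        · subst h3; simp [h, hz, r.irrefl]
        · simp [h, hz, h2, h3]

theorem exists_profile_upper {x : A} {P : N → Finset A} (hP : ∀ i, x ∉ P i) :
    ∃ R : Profile N A, ∀ i, (R i).upper x = P i := by
  choose R hR using fun i => exists_upper_eq (hP i)
  exact ⟨R, hR⟩

theorem Preference.upper_permute (τ : Equiv.Perm A) (r : Preference A) (x : A) :
    (r.permute τ).upper (τ x) = (r.upper x).map τ.toEmbedding := by
  ext z
  simp [Preference.permute, Finset.mem_map_equiv]

theorem Preference.upper_subset {r : Preference A} {x y : A} (h : r.pref x y) :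
    r.upper x ⊂ r.upper y := by
  rw [Finset.ssubset_iff_of_subset]
  · exact ⟨x, by simpa using h, r.self_notMem_upper x⟩
  · intro z hz
    simp only [Preference.mem_upper] at hz ⊢
    exact r.trans _ _ _ hz h

theorem Preference.card_upper_lt (r : Preference A) (x : A) :
    (r.upper x).card < Fintype.card A :=
  Finset.card_lt_univ_of_notMem (r.self_notMem_upper x)

/-- The ranks of the alternatives are `0, …, m - 1`. -/
theorem Preference.sum_card_upper (r : Preference A) (a : ℕ → ℝ) :
    ∑ x, a (r.upper x).card = ∑ t ∈ range (Fintype.card A), a t := by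
  have hinj : Injective fun x => (r.upper x).card := by
    intro x y hxy
    by_contra hne
    rcases r.complete x y hne with h | h
    · exact (Finset.card_lt_card (Preference.upper_subset h)).ne hxy
    · exact (Finset.card_lt_card (Preference.upper_subset h)).ne' hxy
  have himg : univ.image (fun x => (r.upper x).card) = range (Fintype.card A) := by
    apply Finset.eq_of_subset_of_card_le
    · intro t ht
      obtain ⟨x, -, rfl⟩ := Finset.mem_image.1 ht
      exact Finset.mem_range.2 (r.card_upper_lt x)
    · rw [Finset.card_image_of_injective _ hinj]; simp
  rw [← himg, Finset.sum_image hinj.injOn]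

theorem supportingSize_eq_card_upper [Fintype N] (R : Profile N A) {x y : A} (hxy : x ≠ y) :
    supportingSize R x y = (univ.filter fun i => y ∉ (R i).upper x).card := by
  unfold supportingSize
  congr 1
  ext i
  simp [(R i).not_pref_iff hxy.symm]

theorem supportingSize_add {A : Type*} [Fintype N] (R : Profile N A) {x y : A} (hxy : x ≠ y) :
    supportingSize R x y + supportingSize R y x = Fintype.card N := by
  unfold supportingSize
  rw [← Finset.card_univ, ← Finset.card_filter_add_card_filter_not (s := univ) (fun i => (R i).pref x y)]
  congr 2
  exact Finset.filter_congr fun i _ => ((R i).not_pref_iff hxy).symm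

end Preferences

/-! ### Local consequences of strategyproofness -/

section Lifting

variable {N A : Type*} [Fintype A] {f : SDS N A}

/-- A proper initial segment `W` of `r` is the strict upper contour set of the best alternative
outside `W`, so stochastic dominance applies to it. -/
theorem Strategyproof.sum_le (hf : Strategyproof f) (R : Profile N A) (i : N)
    (r r' : Preference A) {W : Finset A} (hW : ∀ y ∈ W, ∀ z, r.pref z y → z ∈ W) :
    ∑ y ∈ W, f (update R i r') y ≤ ∑ y ∈ W, f (update R i r) y := by
  by_cases hu : W = univ
  · subst hu
    exact ((f (update R i r')).2.2.trans (f (update R i r)).2.2.symm).le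
  · have hne : (univ \ W).Nonempty := by
      rw [Finset.sdiff_nonempty]
      exact fun h => hu (Finset.eq_univ_iff_forall.2 fun x => h (mem_univ x))
    obtain ⟨x, hx, hmin⟩ := Finset.exists_min_image (univ \ W) (fun x => (r.upper x).card) hne
    have hxW : x ∉ W := by simpa using hx
    have hup : r.upper x = W := by
      ext z
      rw [Preference.mem_upper]
      constructor
      · intro hz
        by_contra hzW
        have := hmin z (by simpa using hzW)
        exact absurd (Finset.card_lt_card (Preference.upper_subset hz)) (not_lt.2 this)
      · intro hz
        have hzx : z ≠ x := fun h => hxW (h ▸ hz)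
        by_contra hc
        exact hxW (hW z hz x ((r.not_pref_iff hzx).1 hc))
    have := hf (update R i r) (update R i r') i (fun j hj => by simp [hj]) x
    rw [update_self] at this
    rw [← hup]
    exact this

theorem Strategyproof.sum_eq (hf : Strategyproof f) (R : Profile N A) (i : N)
    (r r' : Preference A) {W : Finset A} (hW : ∀ y ∈ W, ∀ z, r.pref z y → z ∈ W)
    (hW' : ∀ y ∈ W, ∀ z, r'.pref z y → z ∈ W) :
    ∑ y ∈ W, f (update R i r') y = ∑ y ∈ W, f (update R i r) y :=
  le_antisymm (hf.sum_le R i r r' hW) (hf.sum_le R i r' r hW')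

theorem Preference.upper_closed (r : Preference A) (x : A) :
    ∀ y ∈ r.upper x, ∀ z, r.pref z y → z ∈ r.upper x := by
  intro y hy z hz
  rw [Preference.mem_upper] at hy ⊢
  exact r.trans _ _ _ hz hy

theorem Preference.insert_upper_closed (r : Preference A) (x : A) :
    ∀ y ∈ insert x (r.upper x), ∀ z, r.pref z y → z ∈ insert x (r.upper x) := by
  intro y hy z hz
  rcases Finset.mem_insert.1 hy with rfl | hy
  · simp [hz]
  · exact Finset.mem_insert_of_mem (r.upper_closed x y hy z hz)

/-- Both the upper contour set and its union with `x` are initial segments of both preferences;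
their probabilities are unchanged, hence so is the difference. -/
theorem Strategyproof.update_eq (hf : Strategyproof f) (R : Profile N A) (i : N)
    {r r' : Preference A} {x : A} (h : r.upper x = r'.upper x) :
    f (update R i r') x = f (update R i r) x := by
  have h1 := hf.sum_eq R i r r' (r.upper_closed x) (h ▸ r'.upper_closed x)
  have h2 := hf.sum_eq R i r r' (r.insert_upper_closed x) (h ▸ r'.insert_upper_closed x)
  rw [Finset.sum_insert (r.self_notMem_upper x), Finset.sum_insert (r.self_notMem_upper x)] at h2
  linarith

/-- The probability of `x` depends only on the upper contour sets of `x`. -/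
theorem Strategyproof.eq_of_upper_eq [Fintype N] (hf : Strategyproof f) {R R' : Profile N A}
    {x : A} (h : ∀ i, (R i).upper x = (R' i).upper x) : f R x = f R' x := by
  have key : ∀ s : Finset N, f (s.piecewise R' R) x = f R x := by
    intro s
    induction s using Finset.induction_on with
    | empty => simp
    | insert j s hj ih =>
      rw [Finset.piecewise_insert, ← ih]
      have := hf.update_eq (s.piecewise R' R) j (r := R j) (r' := R' j) (h j)
      rw [this]
      congr 2
      rw [update_eq_self_iff]
      simp [hj]
  have := key univ
  rw [Finset.piecewise_univ] at this
  exact this.symm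

/-- Swapping two adjacent alternatives does not change their total probability. -/
theorem Strategyproof.add_eq_of_swap (hf : Strategyproof f) (R : Profile N A) (i : N)
    {x y : A} {S : Finset A} (hxy : x ≠ y) {r r' : Preference A}
    (h1 : r.upper y = S) (h2 : r.upper x = insert y S)
    (h3 : r'.upper x = S) (h4 : r'.upper y = insert x S) :
    f (update R i r) x + f (update R i r) y = f (update R i r') x + f (update R i r') y := by
  have hx : x ∉ S := h3 ▸ r'.self_notMem_upper x
  have hy : y ∉ S := h1 ▸ r.self_notMem_upper y
  have e1 := hf.sum_eq R i r r' (W := S) (h1 ▸ r.upper_closed y) (h3 ▸ r'.upper_closed x)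
  have e2 := hf.sum_eq R i r r' (W := insert x (insert y S)) (h2 ▸ r.insert_upper_closed x)
    (by rw [Finset.insert_comm]; exact h4 ▸ r'.insert_upper_closed y)
  rw [Finset.sum_insert (by simp [hxy, hx]), Finset.sum_insert hy,
    Finset.sum_insert (by simp [hxy, hx]), Finset.sum_insert hy] at e2
  linarith

/-- The gain of `x` from being lifted over `y` by voter `i` depends, as far as the other voters
are concerned, only on their preferences between `x` and `y`. -/
theorem Strategyproof.gain_eq [Fintype N] (hf : Strategyproof f) (R R' : Profile N A) (i : N)
    {x y : A} {S : Finset A} (hxy : x ≠ y) (hy : y ∉ S) {r₁ r₂ r₁' r₂' : Preference A}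
    (h1 : r₁.upper x = insert y S) (h2 : r₂.upper x = S)
    (h1' : r₁'.upper x = insert y S) (h2' : r₂'.upper x = S)
    (h : ∀ j, j ≠ i → ((R j).pref x y ↔ (R' j).pref x y)) :
    f (update R i r₂) x - f (update R i r₁) x
      = f (update R' i r₂') x - f (update R' i r₁') x := by
  have hx : x ∉ S := h2 ▸ r₂.self_notMem_upper x
  obtain ⟨ρ₁, hρ₁y, hρ₁x⟩ := exists_upper_eq_pair hxy.symm hy hx
  obtain ⟨ρ₂, hρ₂x, hρ₂y⟩ := exists_upper_eq_pair hxy hx hy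
  -- Sending `y` to an extreme keeps the probability of `x`, while the upper contour set of `y` then
  -- records nothing but the voter's opinion on `x` against `y`. For voter `i`, `x` and `y` are made
  -- adjacent right below `S`.
  choose Q hQx hQy using fun j => exists_move_extreme (R j) hxy
  choose Q' hQx' hQy' using fun j => exists_move_extreme (R' j) hxy
  have move : ∀ (R Q : Profile N A) (r ρ : Preference A) (x : A), r.upper x = ρ.upper x →
      (∀ j, j ≠ i → (Q j).upper x = (R j).upper x) →
      f (update R i r) x = f (update Q i ρ) x := by
    intro R Q r ρ x hr hQ
    refine hf.eq_of_upper_eq fun j => ?_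
    by_cases hj : j = i
    · subst hj; simp [hr]
    · simp [hj, hQ j hj]
  rw [move R Q r₂ ρ₂ x (by rw [h2, hρ₂x]) (fun j _ => hQx j),
    move R Q r₁ ρ₁ x (by rw [h1, hρ₁x]) (fun j _ => hQx j),
    move R' Q' r₂' ρ₂ x (by rw [h2', hρ₂x]) (fun j _ => hQx' j),
    move R' Q' r₁' ρ₁ x (by rw [h1', hρ₁x]) (fun j _ => hQx' j)]
  have e1 := hf.add_eq_of_swap Q i hxy hρ₁y hρ₁x hρ₂x hρ₂y
  have e2 := hf.add_eq_of_swap Q' i hxy hρ₁y hρ₁x hρ₂x hρ₂y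
  have hQQ : ∀ j, j ≠ i → (Q' j).upper y = (Q j).upper y := by
    intro j hj
    rw [hQy, hQy']
    simp only [h j hj]
  have e3 := move Q Q' ρ₁ ρ₁ y rfl hQQ
  have e4 := move Q Q' ρ₂ ρ₂ y rfl hQQ
  linarith

end Lifting

/-! ### Permutations matching finite sets and points -/

theorem exists_perm_mem_iff {α : Type*} [Fintype α] {S T : Finset α} (h : S.card = T.card) :
    ∃ σ : Equiv.Perm α, ∀ a, σ a ∈ T ↔ a ∈ S := by
  have e : {a // a ∈ S} ≃ {a // a ∈ T} := Fintype.equivOfCardEq (by simpa using h)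
  refine ⟨e.extendSubtype, fun a => ⟨fun ha => ?_, fun ha => e.extendSubtype_mem a ha⟩⟩
  by_contra hc
  exact e.extendSubtype_not_mem a hc ha

/-- Permutations can be chosen to map a point outside `S` to a prescribed point outside `T`. -/
theorem exists_perm_mem_iff_apply {α : Type*} [Fintype α] {S T : Finset α}
    (h : S.card = T.card) {x x' : α} (hx : x ∉ S) (hx' : x' ∉ T) :
    ∃ σ : Equiv.Perm α, (∀ a, σ a ∈ T ↔ a ∈ S) ∧ σ x = x' := by
  obtain ⟨σ, hσ⟩ := exists_perm_mem_iff h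
  refine ⟨σ.trans (Equiv.swap (σ x) x'), fun a => ?_, by simp⟩
  rw [← hσ a, Equiv.trans_apply]
  have hx2 : σ x ∉ T := by rw [hσ]; exact hx
  rcases eq_or_ne (σ a) (σ x) with h1 | h1
  · rw [h1, Equiv.swap_apply_left]; simp [hx', hx2]
  · rcases eq_or_ne (σ a) x' with h2 | h2
    · rw [h2, Equiv.swap_apply_right]; simp [hx', hx2]
    · rw [Equiv.swap_apply_of_ne_of_ne h1 h2]

/-- A permutation matching `insert x S` with `insert x' T` and `y` with `y'` is corrected by
swapping `σ x` with `x'`, both of which lie in `insert x' T`. -/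
theorem exists_perm_mem_iff_apply₂ {α : Type*} [Fintype α] {S T : Finset α}
    (h : S.card = T.card) {x y x' y' : α} (hxy : x ≠ y) (hx : x ∉ S) (hy : y ∉ S)
    (hxy' : x' ≠ y') (hx' : x' ∉ T) (hy' : y' ∉ T) :
    ∃ σ : Equiv.Perm α, (∀ a, σ a ∈ T ↔ a ∈ S) ∧ σ x = x' ∧ σ y = y' := by
  obtain ⟨σ, hσ, hσx⟩ := exists_perm_mem_iff_apply (S := insert x S) (T := insert x' T)
    (x := y) (x' := y') (by simp [hx, hx', h]) (by simp [hxy.symm, hy]) (by simp [hxy'.symm, hy'])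
  refine ⟨σ.trans (Equiv.swap (σ x) x'), fun a => ?_, by simp, ?_⟩
  · have h0 := hσ a
    have h1 : σ x ∈ insert x' T := (hσ x).2 (by simp)
    rw [Equiv.trans_apply]
    rcases eq_or_ne a x with h2 | h2
    · subst h2; simp [hx, hx']
    · have h3 : σ a ≠ σ x := σ.injective.ne h2
      rcases eq_or_ne (σ a) x' with h4 | h4
      · rw [h4, Equiv.swap_apply_right]
        have h5 : a ∈ S := by simpa [h4, h2] using h0
        have h6 : σ x ∈ T := by
          rcases Finset.mem_insert.1 h1 with h | h
          · exact absurd (h4.trans h.symm) h3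
          · exact h
        simp [h5, h6]
      · rw [Equiv.swap_apply_of_ne_of_ne h3 h4]
        simpa [h4, h2] using h0
  · have h1 : σ x ≠ y' := hσx ▸ σ.injective.ne hxy
    rw [Equiv.trans_apply, hσx, Equiv.swap_apply_of_ne_of_ne h1.symm hxy'.symm]

/-! ### The gain function under anonymity and neutrality -/

section Gain

variable {N A : Type*} [Fintype N] [Fintype A] {f : SDS N A}

theorem Neutral.apply_relabel {N : Type*} {f : SDS N A} (hn : Neutral f) (ha : Anonymous f) (R : Profile N A)
    (π : Equiv.Perm N) (τ : Equiv.Perm A) (x : A) :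
    f R x = f (fun i => (R (π.symm i)).permute τ) (τ x) := by
  rw [hn R τ x, ha _ π]
  rfl

/-- Under anonymity and neutrality, the gain of `x` from being lifted over `y` by a voter depends
only on the rank at which this happens and on the number of voters preferring `x` to `y`. -/
theorem gain_eq_of_card_eq (hf : Strategyproof f) (ha : Anonymous f) (hn : Neutral f)
    {R R' : Profile N A} {i i' : N} {x y x' y' : A} {S S' : Finset A} {r r' : Preference A}
    (hxy : x ≠ y) (hy : y ∉ S) (h1 : (R i).upper x = insert y S) (h2 : r.upper x = S)
    (hxy' : x' ≠ y') (hy' : y' ∉ S') (h1' : (R' i').upper x' = insert y' S')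
    (h2' : r'.upper x' = S') (hS : S.card = S'.card)
    (hk : supportingSize R x y = supportingSize R' x' y') :
    f (update R i r) x - f R x = f (update R' i' r') x' - f R' x' := by
  have hx : x ∉ S := h2 ▸ r.self_notMem_upper x
  have hx' : x' ∉ S' := h2' ▸ r'.self_notMem_upper x'
  -- `τ` matches the alternatives involved in the two lifts; below, `π` matches the lifting voters
  -- and the supporters of `x` over `y`. After renaming, the profiles agree on the pair and
  -- `Strategyproof.gain_eq` applies.
  obtain ⟨τ, hτ, rfl, rfl⟩ := exists_perm_mem_iff_apply₂ hS hxy hx hy hxy' hx' hy'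
  have hyx : (R i).pref y x := by rw [← Preference.mem_upper, h1]; simp
  have hyx' : (R' i').pref (τ y) (τ x) := by rw [← Preference.mem_upper, h1']; simp
  obtain ⟨π, hπ, rfl⟩ := exists_perm_mem_iff_apply hk (x := i) (x' := i')
    (by simp [(R i).asymm hyx]) (by simp [(R' i').asymm hyx'])
  have hmap : S.map τ.toEmbedding = S' := by
    ext z
    rw [Finset.mem_map_equiv, ← hτ, Equiv.apply_symm_apply]
  rw [hn.apply_relabel ha R π τ x, hn.apply_relabel ha (update R i r) π τ x]
  set Q : Profile N A := fun j => (R (π.symm j)).permute τ with hQ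
  have e : (fun j => (update R i r (π.symm j)).permute τ) = update Q (π i) (r.permute τ) := by
    funext j
    by_cases hj : j = π i
    · subst hj; simp
    · have : π.symm j ≠ i := fun h => hj (by rw [← h]; simp)
      simp [hj, this, hQ]
  rw [e]
  have key := hf.gain_eq Q R' (π i) hxy' hy' (r₁ := Q (π i)) (r₂ := r.permute τ)
    (r₁' := R' (π i)) (r₂' := r') (by simp [hQ, Preference.upper_permute, h1, ← hmap])
    (by simp [Preference.upper_permute, h2, ← hmap]) h1' h2' (fun j _ => by
      have := hπ (π.symm j)
      simp only [Finset.mem_filter, Finset.mem_univ, true_and, Equiv.apply_symm_apply] at this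
      rw [this]
      simp [hQ, Preference.permute])
  simpa only [update_eq_self] using key

theorem exists_gain (hf : Strategyproof f) (ha : Anonymous f) (hn : Neutral f) :
    ∃ D : ℕ → ℕ → ℝ, ∀ (R : Profile N A) (i : N) (x y : A) (S : Finset A) (r : Preference A),
      x ≠ y → y ∉ S → (R i).upper x = insert y S → r.upper x = S →
      f (update R i r) x - f R x = D S.card (supportingSize R x y) := by
  let P : ℕ → ℕ → ℝ → Prop := fun s k v =>
    ∃ (R : Profile N A) (i : N) (x y : A) (S : Finset A) (r : Preference A),
      x ≠ y ∧ y ∉ S ∧ (R i).upper x = insert y S ∧ r.upper x = S ∧ S.card = s ∧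
      supportingSize R x y = k ∧ f (update R i r) x - f R x = v
  -- Where no lift realizes `(s, k)`, the value `0` is never used.
  refine ⟨fun s k => if h : ∃ v, P s k v then h.choose else 0, ?_⟩
  intro R i x y S r hxy hy h1 h2
  have hex : ∃ v, P S.card (supportingSize R x y) v :=
    ⟨_, R, i, x, y, S, r, hxy, hy, h1, h2, rfl, rfl, rfl⟩
  obtain ⟨R', i', x', y', S', r', hxy', hy', h1', h2', hS, hk, hv⟩ := hex.choose_spec
  simp only [dif_pos hex]
  rw [← hv]
  exact gain_eq_of_card_eq hf ha hn hxy hy h1 h2 hxy' hy' h1' h2' hS.symm hk.symm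

theorem supportingSize_update_lift {A : Type*} {R : Profile N A} {i : N} {x y : A} {r : Preference A}
    (h : (R i).pref y x) (h' : r.pref x y) :
    supportingSize (update R i r) x y = supportingSize R x y + 1 := by
  unfold supportingSize
  rw [← Finset.card_insert_of_notMem (a := i)
    (s := univ.filter fun j => (R j).pref x y) (by simp [(R i).asymm h])]
  congr 1
  ext j
  by_cases hj : j = i
  · subst hj; simp [h']
  · simp [hj]

theorem supportingSize_update_of_iff {A : Type*} {R : Profile N A} {i : N} {x y : A} {r : Preference A}
    (h : r.pref x y ↔ (R i).pref x y) :
    supportingSize (update R i r) x y = supportingSize R x y := by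
  unfold supportingSize
  congr 1
  ext j
  by_cases hj : j = i
  · subst hj; simp [h]
  · simp [hj]

/-- Two voters lift `x` over `y`, at ranks `s` and `t`. Either order leads to the same profile, and
the second lift sees one more supporter of `x`. -/
theorem gain_exchange (hN : 2 ≤ Fintype.card N) {D : ℕ → ℕ → ℝ}
    (hD : ∀ (R : Profile N A) (i : N) (x y : A) (S : Finset A) (r : Preference A),
      x ≠ y → y ∉ S → (R i).upper x = insert y S → r.upper x = S →
      f (update R i r) x - f R x = D S.card (supportingSize R x y))
    {s t k : ℕ} (hs : s + 1 < Fintype.card A) (ht : t + 1 < Fintype.card A)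
    (hk : k + 1 < Fintype.card N) :
    D s k + D t (k + 1) = D t k + D s (k + 1) := by
  obtain ⟨x, y, hxy⟩ := Fintype.exists_pair_of_one_lt_card (show 1 < Fintype.card A by omega)
  obtain ⟨i, j, hij⟩ := Fintype.exists_pair_of_one_lt_card (show 1 < Fintype.card N by omega)
  have hcA : (univ \ {x, y} : Finset A).card = Fintype.card A - 2 := by
    rw [Finset.card_sdiff_of_subset (subset_univ _), Finset.card_pair hxy, Finset.card_univ]
  have hcN : (univ \ {i, j} : Finset N).card = Fintype.card N - 2 := by
    rw [Finset.card_sdiff_of_subset (subset_univ _), Finset.card_pair hij, Finset.card_univ]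
  obtain ⟨S, hS, rfl⟩ := Finset.exists_subset_card_eq (hcA ▸ (by omega : s ≤ Fintype.card A - 2))
  obtain ⟨T, hT, rfl⟩ := Finset.exists_subset_card_eq (hcA ▸ (by omega : t ≤ Fintype.card A - 2))
  obtain ⟨K, hK, rfl⟩ := Finset.exists_subset_card_eq (hcN ▸ (by omega : k ≤ Fintype.card N - 2))
  have hxS : x ∉ S := fun h => by simpa using hS h
  have hyS : y ∉ S := fun h => by simpa using hS h
  have hxT : x ∉ T := fun h => by simpa using hT h
  have hyT : y ∉ T := fun h => by simpa using hT h
  have hiK : i ∉ K := fun h => by simpa using hK h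
  have hjK : j ∉ K := fun h => by simpa using hK h
  obtain ⟨R, hR⟩ := exists_profile_upper (x := x)
    (P := fun l => if l = i then insert y S else if l = j then insert y T
      else if l ∈ K then ∅ else {y}) (by
      intro l
      by_cases h1 : l = i
      · simp [h1, hxy, hxS]
      · by_cases h2 : l = j
        · simp [h2, hij.symm, hxy, hxT]
        · by_cases h3 : l ∈ K <;> simp [h1, h2, h3, hxy])
  obtain ⟨r, hr⟩ := exists_upper_eq hxS
  obtain ⟨q, hq⟩ := exists_upper_eq hxT
  have hRi : (R i).upper x = insert y S := by simp [hR]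
  have hRj : (R j).upper x = insert y T := by simp [hR, hij.symm]
  have hRK : supportingSize R x y = K.card := by
    rw [supportingSize_eq_card_upper R hxy]
    congr 1
    ext l
    simp only [hR, Finset.mem_filter, Finset.mem_univ, true_and]
    by_cases h1 : l = i
    · simp [h1, hiK]
    · by_cases h2 : l = j
      · simp [h2, hij.symm, hjK]
      · by_cases h3 : l ∈ K <;> simp [h1, h2, h3]
  have pi : (R i).pref y x := by rw [← Preference.mem_upper, hRi]; simp
  have pj : (R j).pref y x := by rw [← Preference.mem_upper, hRj]; simp
  have pr : r.pref x y := by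
    rw [← r.not_pref_iff hxy.symm, ← Preference.mem_upper, hr]; exact hyS
  have pq : q.pref x y := by
    rw [← q.not_pref_iff hxy.symm, ← Preference.mem_upper, hq]; exact hyT
  have e1 := hD R i x y S r hxy hyS hRi hr
  have e2 := hD R j x y T q hxy hyT hRj hq
  have e3 := hD (update R i r) j x y T q hxy hyT (by simp [hij.symm, hRj]) hq
  have e4 := hD (update R j q) i x y S r hxy hyS (by simp [hij, hRi]) hr
  rw [supportingSize_update_lift pi pr, hRK] at e3
  rw [supportingSize_update_lift pj pq, hRK] at e4
  rw [hRK] at e1 e2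
  rw [update_comm hij.symm] at e4
  linarith

/-- Undoing an adjacent swap lifts `y` over `x` when `y` has `n - 1 - k` supporters. As the two
share a fixed total probability, this gives back exactly what `x` gained. -/
theorem gain_nonneg_and_symm (hf : Strategyproof f) {D : ℕ → ℕ → ℝ}
    (hD : ∀ (R : Profile N A) (i : N) (x y : A) (S : Finset A) (r : Preference A),
      x ≠ y → y ∉ S → (R i).upper x = insert y S → r.upper x = S →
      f (update R i r) x - f R x = D S.card (supportingSize R x y))
    {s k : ℕ} (hs : s + 1 < Fintype.card A) (hk : k < Fintype.card N) :
    0 ≤ D s k ∧ D s (Fintype.card N - 1 - k) = D s k := by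
  obtain ⟨x, y, hxy⟩ := Fintype.exists_pair_of_one_lt_card (show 1 < Fintype.card A by omega)
  obtain ⟨i⟩ : Nonempty N := Fintype.card_pos_iff.1 (by omega)
  have hcA : (univ \ {x, y} : Finset A).card = Fintype.card A - 2 := by
    rw [Finset.card_sdiff_of_subset (subset_univ _), Finset.card_pair hxy, Finset.card_univ]
  have hcN : (univ.erase i : Finset N).card = Fintype.card N - 1 := by
    rw [Finset.card_erase_of_mem (mem_univ _), Finset.card_univ]
  obtain ⟨S, hS, rfl⟩ := Finset.exists_subset_card_eq (hcA ▸ (by omega : s ≤ Fintype.card A - 2))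
  obtain ⟨K, hK, rfl⟩ := Finset.exists_subset_card_eq (hcN ▸ (by omega : k ≤ Fintype.card N - 1))
  have hxS : x ∉ S := fun h => by simpa using hS h
  have hyS : y ∉ S := fun h => by simpa using hS h
  have hiK : i ∉ K := fun h => by simpa using hK h
  obtain ⟨ρ₁, h1y, h1x⟩ := exists_upper_eq_pair hxy.symm hyS hxS
  obtain ⟨ρ₂, h2x, h2y⟩ := exists_upper_eq_pair hxy hxS hyS
  have p1 : ρ₁.pref y x := by rw [← Preference.mem_upper, h1x]; simp
  have p2 : ρ₂.pref x y := by rw [← Preference.mem_upper, h2y]; simp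
  set R : Profile N A := fun l => if l ∈ K then ρ₂ else ρ₁ with hR
  have hRi : R i = ρ₁ := by simp [hR, hiK]
  have hRK : supportingSize R x y = K.card := by
    unfold supportingSize
    congr 1
    ext l
    simp only [hR, Finset.mem_filter, Finset.mem_univ, true_and]
    by_cases h3 : l ∈ K <;> simp [h3, p2, ρ₁.asymm p1]
  have e0 : update R i ρ₁ = R := by rw [← hRi, update_eq_self]
  have e1 := hD R i x y S ρ₂ hxy hyS (by rw [hRi, h1x]) h2x
  have e2 := hD (update R i ρ₂) i y x S ρ₁ hxy.symm hxS (by rw [update_self, h2y]) h1y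
  rw [update_idem, e0] at e2
  have hsz := supportingSize_add (update R i ρ₂) hxy
  rw [supportingSize_update_lift (hRi ▸ p1) p2, hRK] at hsz
  have e3 := hf.add_eq_of_swap R i hxy h1y h1x h2x h2y
  rw [e0] at e3
  have hle := hf.sum_le R i ρ₂ ρ₁ (h2x ▸ ρ₂.insert_upper_closed x)
  have heq := hf.sum_eq R i ρ₁ ρ₂ (h1y ▸ ρ₁.upper_closed y) (h2x ▸ ρ₂.upper_closed x)
  rw [Finset.sum_insert hxS, Finset.sum_insert hxS, e0] at hle
  rw [e0] at heq
  rw [hRK] at e1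
  refine ⟨by linarith, ?_⟩
  have : Fintype.card N - 1 - K.card = supportingSize (update R i ρ₂) y x := by omega
  rw [this]
  linarith

end Gain

/-! ### Decomposition into point voting and supporting size parts -/

section Decomposition

variable {N A : Type*} [Fintype N] [Fintype A] {f : SDS N A}

/-- Every strategyproof, anonymous and neutral SDS is the sum of a point voting part with
decreasing non-negative weights `a` and a supporting size part with increasing weights `b`. -/
theorem exists_decomposition [Nonempty A] (hN : 2 ≤ Fintype.card N) (hA : 2 ≤ Fintype.card A)
    (hf : Strategyproof f) (ha : Anonymous f) (hn : Neutral f) :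
    ∃ a b : ℕ → ℝ,
      (∀ R x, f R x = ∑ i, a ((R i).upper x).card
        + ∑ y ∈ univ.erase x, b (supportingSize R x y)) ∧
      (∀ t, t + 1 < Fintype.card A → a (t + 1) ≤ a t) ∧
      0 ≤ a (Fintype.card A - 1) ∧ b 0 = 0 ∧
      (∀ k < Fintype.card N, b k ≤ b (k + 1)) ∧
      (∀ k ≤ Fintype.card N, b k + b (Fintype.card N - k) = b (Fintype.card N)) := by
  obtain ⟨D, hD⟩ := exists_gain hf ha hn
  set n := Fintype.card N with hn_def
  set m := Fintype.card A with hm_def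
  -- By separability `D s k = D s l + (D 0 k - D 0 l)`. Taking `l` minimal for `D 0` makes the
  -- second summand nonnegative, while the first is nonnegative as a gain.
  obtain ⟨l, hl, hmin⟩ := Finset.exists_min_image (range n) (D 0) ⟨0, by simp; omega⟩
  rw [Finset.mem_range] at hl
  have hsep : ∀ s, s + 1 < m → ∀ k, k < n → D s k = D s 0 + D 0 k - D 0 0 := by
    intro s hs k
    induction k with
    | zero => intro _; ring
    | succ k ih =>
      intro hk
      have := gain_exchange hN hD (s := s) (t := 0) (k := k) hs (by omega) hk
      have := ih (by omega)
      linarith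
  obtain ⟨x₀⟩ := ‹Nonempty A›
  obtain ⟨R₀, hR₀⟩ := exists_profile_upper (N := N) (x := x₀) (P := fun _ => ∅) (by simp)
  set d : ℕ → ℝ := fun k => D 0 k - D 0 l with hd
  set e : ℕ → ℝ := fun t => D t l with he
  set b : ℕ → ℝ := fun k => ∑ j ∈ range k, d j with hb
  -- `c` is the weight of the top rank, fixed by a profile where `x₀` is unanimously first.
  set c : ℝ := (f R₀ x₀ - ((m : ℝ) - 1) * b n) / n with hc
  set a : ℕ → ℝ := fun t => c - ∑ j ∈ range t, e j with ha'
  have hb_succ : ∀ k, b (k + 1) = b k + d k := fun k => Finset.sum_range_succ _ _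
  have ha_succ : ∀ t, a (t + 1) = a t - e t := fun t => by
    simp only [ha', Finset.sum_range_succ]; ring
  have hcard : ∀ x : A, ((univ.erase x).card : ℝ) = (m : ℝ) - 1 := by
    intro x
    rw [Finset.card_erase_of_mem (mem_univ _), Finset.card_univ, Nat.cast_sub (by omega)]
    simp [hm_def]
  have hn0 : (n : ℝ) ≠ 0 := by
    have : 0 < n := by omega
    positivity
  have hbase : ∀ (R : Profile N A) (x : A), (∀ i, (R i).upper x = ∅) → f R x = f R₀ x₀ := by
    intro R x hR
    rw [hn R (Equiv.swap x x₀) x, Equiv.swap_apply_left]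
    refine hf.eq_of_upper_eq fun i => ?_
    have := Preference.upper_permute (Equiv.swap x x₀) (R i) x
    rw [Equiv.swap_apply_left, hR i] at this
    rw [hR₀ i]
    simpa [Profile.permuteAlternatives] using this
  have hrep : ∀ (K : ℕ) (R : Profile N A) (x : A), ∑ i, ((R i).upper x).card = K →
      f R x = ∑ i, a ((R i).upper x).card
        + ∑ y ∈ univ.erase x, b (supportingSize R x y) := by
    intro K
    induction K with
    | zero =>
      intro R x hK
      have hR : ∀ i, (R i).upper x = ∅ := fun i => by
        have := (Finset.sum_eq_zero_iff.1 hK) i (mem_univ i)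
        simpa using this
      have h1 : ∀ y ∈ univ.erase x, b (supportingSize R x y) = b n := by
        intro y hy
        have hxy : x ≠ y := (Finset.ne_of_mem_erase hy).symm
        rw [supportingSize_eq_card_upper R hxy]
        simp [hR, hn_def]
      rw [hbase R x hR, Finset.sum_congr rfl h1, Finset.sum_const, nsmul_eq_mul, hcard]
      simp only [hR, Finset.card_empty, Finset.sum_const, Finset.card_univ, nsmul_eq_mul]
      simp only [ha', Finset.range_zero, Finset.sum_empty, hc, ← hn_def]
      field_simp
      ring
    | succ K ih =>
      intro R x hK
      -- Induction on the total rank of `x`: lifting `x` over one `y` in one voter lowers it by one,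
      -- and the formula changes by `e + d`, which is the gain.
      obtain ⟨i, -, hi⟩ : ∃ i ∈ univ, ((R i).upper x).card ≠ 0 := by
        by_contra! hcon
        rw [Finset.sum_eq_zero hcon] at hK
        omega
      obtain ⟨y, hy⟩ := Finset.card_ne_zero.1 hi
      set S := ((R i).upper x).erase y with hS
      have hyS : y ∉ S := Finset.notMem_erase _ _
      have hRi : (R i).upper x = insert y S := (Finset.insert_erase hy).symm
      have hxS : x ∉ S := fun h => (R i).self_notMem_upper x (Finset.mem_of_mem_erase h)
      have hxy : x ≠ y := fun h => (R i).self_notMem_upper x (h ▸ hy)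
      obtain ⟨r, hr⟩ := exists_upper_eq hxS
      have hcS : ((R i).upper x).card = S.card + 1 := by
        rw [hRi, Finset.card_insert_of_notMem hyS]
      have hsum : ∀ g : ℕ → ℝ, ∑ j, g ((update R i r j).upper x).card
          = ∑ j, g ((R j).upper x).card - g (S.card + 1) + g S.card := by
        intro g
        rw [← Finset.add_sum_erase _ _ (mem_univ i),
          ← Finset.add_sum_erase univ (fun j => g ((R j).upper x).card) (mem_univ i),
          update_self, hr, hcS]
        have : ∀ j ∈ univ.erase i, g ((update R i r j).upper x).card
            = g ((R j).upper x).card := by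
          intro j hj
          rw [update_of_ne (Finset.ne_of_mem_erase hj)]
        rw [Finset.sum_congr rfl this]
        ring
      have hK' : ∑ j, ((update R i r j).upper x).card = K := by
        have := hsum (fun t => (t : ℝ))
        rw [← Nat.cast_sum, ← Nat.cast_sum, hK] at this
        push_cast at this
        have h2 : ((∑ j, ((update R i r j).upper x).card : ℕ) : ℝ) = (K : ℝ) := by
          push_cast
          linarith
        exact_mod_cast h2
      have hih := ih _ x hK'
      have pi : (R i).pref y x := by simpa using hy
      have pr : r.pref x y := by
        rw [← r.not_pref_iff hxy.symm, ← Preference.mem_upper, hr]; exact hyS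
      have hbsum : ∑ z ∈ univ.erase x, b (supportingSize (update R i r) x z)
          = ∑ z ∈ univ.erase x, b (supportingSize R x z) + d (supportingSize R x y) := by
        have hmem : y ∈ univ.erase x := by simp [hxy.symm]
        rw [← Finset.add_sum_erase _ _ hmem, ← Finset.add_sum_erase (univ.erase x)
          (fun z => b (supportingSize R x z)) hmem, supportingSize_update_lift pi pr, hb_succ]
        have : ∀ z ∈ (univ.erase x).erase y, b (supportingSize (update R i r) x z)
            = b (supportingSize R x z) := by
          intro z hz
          have hzy : z ≠ y := Finset.ne_of_mem_erase hz
          have hzx : z ≠ x := Finset.ne_of_mem_erase (Finset.mem_of_mem_erase hz)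
          rw [supportingSize_update_of_iff]
          rw [← r.not_pref_iff hzx, ← (R i).not_pref_iff hzx, ← Preference.mem_upper,
            ← Preference.mem_upper, hr, hRi, Finset.mem_insert]
          simp [hzy]
        rw [Finset.sum_congr rfl this]
        ring
      rw [hsum a, hbsum, ha_succ] at hih
      have hgain := hD R i x y S r hxy hyS hRi hr
      have hSm : S.card + 1 < m := hcS ▸ (R i).card_upper_lt x
      have hkn : supportingSize R x y < n := by
        rw [supportingSize, hn_def, ← Finset.card_univ]
        refine Finset.card_lt_card (Finset.ssubset_univ_iff.2 fun h => ?_)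
        have := Finset.eq_univ_iff_forall.1 h i
        simp [(R i).asymm pi] at this
      have h1 := hsep _ hSm _ hkn
      have h2 := hsep _ hSm _ hl
      simp only [he, hd] at hih
      linarith
  have hd_nonneg : ∀ k < n, 0 ≤ d k := fun k hk => by
    have := hmin k (by simpa using hk)
    simp only [hd]
    linarith
  have hd_symm : ∀ k < n, d (n - 1 - k) = d k := fun k hk => by
    have := (gain_nonneg_and_symm hf hD (s := 0) (k := k) (by omega) hk).2
    simp only [hd, hn_def]
    rw [this]
  refine ⟨a, b, fun R x => hrep _ R x rfl, fun t ht => ?_, ?_, by simp [hb], fun k hk => ?_, ?_⟩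
  · rw [ha_succ]
    have := (gain_nonneg_and_symm hf hD (s := t) (k := l) ht hl).1
    simp only [he]
    linarith
  -- When `x₀` is unanimously last its `b` part vanishes, so its probability is `n * a (m - 1)`.
  · obtain ⟨R, hR⟩ := exists_profile_upper (N := N) (x := x₀) (P := fun _ => univ.erase x₀)
      (by simp)
    have h := hrep _ R x₀ rfl
    have h1 : ∀ y ∈ univ.erase x₀, b (supportingSize R x₀ y) = 0 := by
      intro y hy
      have hxy : x₀ ≠ y := (Finset.ne_of_mem_erase hy).symm
      rw [supportingSize_eq_card_upper R hxy]
      simp [hR, hb, hxy.symm]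
    have hcard' : (univ.erase x₀).card = m - 1 := by
      rw [Finset.card_erase_of_mem (mem_univ _), Finset.card_univ]
    rw [Finset.sum_eq_zero h1, add_zero] at h
    simp only [hR, hcard', Finset.sum_const, Finset.card_univ, nsmul_eq_mul] at h
    have h0 : 0 ≤ f R x₀ := (f R).2.1 x₀
    rw [h] at h0
    have hnpos : (0 : ℝ) < n := by
      have : 0 < n := by omega
      exact_mod_cast this
    exact nonneg_of_mul_nonneg_right h0 hnpos
  · rw [hb_succ]
    have := hd_nonneg k hk
    linarith
  · intro k
    induction k with
    | zero => intro _; simp [hb]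
    | succ k ih =>
      intro hk
      have h1 := ih (by omega)
      have h2 : b (n - k) = b (n - (k + 1)) + d (n - (k + 1)) := by
        rw [← hb_succ]
        congr 1
        omega
      have h3 : d (n - (k + 1)) = d k := by
        rw [← hd_symm k (by omega)]
        congr 1
        omega
      rw [hb_succ]
      linarith

/-- Total probability one, in terms of the weights of the decomposition. -/
theorem sum_weights_eq_one {a b : ℕ → ℝ} {R : Profile N A}
    (h : ∀ x, f R x = ∑ i, a ((R i).upper x).card
        + ∑ y ∈ univ.erase x, b (supportingSize R x y))
    (hb : ∀ k ≤ Fintype.card N, b k + b (Fintype.card N - k) = b (Fintype.card N)) :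
    Fintype.card N * ∑ t ∈ range (Fintype.card A), a t
      + (Fintype.card A : ℝ) * ((Fintype.card A : ℝ) - 1) / 2 * b (Fintype.card N) = 1 := by
  have h1 : ∑ x, f R x = 1 := (f R).2.2
  simp only [h, Finset.sum_add_distrib] at h1
  rw [Finset.sum_comm] at h1
  simp only [Preference.sum_card_upper, Finset.sum_const, Finset.card_univ, nsmul_eq_mul] at h1
  have e : ∀ x, ∑ y ∈ univ.erase x, b (supportingSize R x y)
      = ∑ y, if x ≠ y then b (supportingSize R x y) else 0 := by
    intro x
    rw [← Finset.sum_filter]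
    refine Finset.sum_congr ?_ fun _ _ => rfl
    ext y
    simp [eq_comm]
  have h2 : ∑ x, ∑ y ∈ univ.erase x, b (supportingSize R x y)
      + ∑ x, ∑ y ∈ univ.erase x, b (supportingSize R x y)
      = (Fintype.card A : ℝ) * ((Fintype.card A : ℝ) - 1) * b (Fintype.card N) := by
    simp only [e]
    nth_rewrite 2 [Finset.sum_comm]
    rw [← Finset.sum_add_distrib]
    have : ∀ x : A, (∑ y, if x ≠ y then b (supportingSize R x y) else 0)
        + (∑ y, if y ≠ x then b (supportingSize R y x) else 0)
        = ((Fintype.card A : ℝ) - 1) * b (Fintype.card N) := by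
      intro x
      rw [← Finset.sum_add_distrib]
      have : ∀ y, ((if x ≠ y then b (supportingSize R x y) else 0)
          + if y ≠ x then b (supportingSize R y x) else 0)
          = b (Fintype.card N) - if y = x then b (Fintype.card N) else 0 := by
        intro y
        by_cases hxy : x = y
        · simp [hxy]
        · have hs := supportingSize_add R hxy
          have := hb (supportingSize R x y) (by omega)
          rw [show Fintype.card N - supportingSize R x y = supportingSize R y x by omega] at this
          simp [hxy, Ne.symm hxy, this]
      simp only [this]
      rw [Finset.sum_sub_distrib]
      simp
      ring
    simp only [this]
    simp
    ring
  linarith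

end Decomposition

/-! ### Ranks with small total weight -/

section WeightBounds

variable {m : ℕ} {a : ℕ → ℝ}

theorem weights_antitone (ha : ∀ t, t + 1 < m → a (t + 1) ≤ a t) {s t : ℕ} (hst : s ≤ t)
    (ht : t < m) : a t ≤ a s := by
  induction t, hst using Nat.le_induction with
  | base => exact le_rfl
  | succ t _ ih => exact (ha t ht).trans (ih (by omega))

theorem weights_nonneg (ha : ∀ t, t + 1 < m → a (t + 1) ≤ a t) (h0 : 0 ≤ a (m - 1)) {t : ℕ}
    (ht : t < m) : 0 ≤ a t :=
  h0.trans (weights_antitone ha (by omega) (by omega))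

theorem sum_range_le (ha : ∀ t < m, 0 ≤ a t) {h : ℕ} (hh : h ≤ m) :
    ∑ t ∈ range h, a t ≤ ∑ t ∈ range m, a t :=
  Finset.sum_le_sum_of_subset_of_nonneg (Finset.range_subset_range.2 hh)
    fun t ht _ => ha t (by simpa using ht)

/-- Some pair of ranks with sum `h` has at most twice the average weight. -/
theorem exists_pair_weight_le (ha : ∀ t < m, 0 ≤ a t) {h : ℕ} (hh : h < m) :
    ∃ s ≤ h, ((h : ℝ) + 1) * (a s + a (h - s)) ≤ 2 * ∑ t ∈ range m, a t := by
  have hsum : ∑ s ∈ range (h + 1), (a s + a (h - s)) = 2 * ∑ s ∈ range (h + 1), a s := by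
    rw [Finset.sum_add_distrib, Finset.sum_flip a]
    ring
  obtain ⟨s, hs, hmin⟩ := Finset.exists_min_image (range (h + 1)) (fun s => a s + a (h - s))
    ⟨0, by simp⟩
  refine ⟨s, by simpa [Nat.lt_succ_iff] using hs, ?_⟩
  have h1 := Finset.card_nsmul_le_sum (range (h + 1)) _ _ hmin
  rw [hsum, Finset.card_range, nsmul_eq_mul] at h1
  push_cast at h1
  have := sum_range_le ha (show h + 1 ≤ m by omega)
  linarith

/-- The `s + 1` best ranks each weigh at least `a s`. -/
theorem succ_mul_weight_le (ha : ∀ t, t + 1 < m → a (t + 1) ≤ a t) (h0 : 0 ≤ a (m - 1)) {s : ℕ}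
    (hs : s < m) : ((s : ℝ) + 1) * a s ≤ ∑ t ∈ range m, a t := by
  refine le_trans ?_ (sum_range_le (fun t ht => weights_nonneg ha h0 ht) (show s + 1 ≤ m by omega))
  have := Finset.card_nsmul_le_sum (range (s + 1)) a (a s)
    (fun t ht => weights_antitone ha (by simpa [Nat.lt_succ_iff] using ht) hs)
  rw [Finset.card_range, nsmul_eq_mul] at this
  exact_mod_cast this

/-- If `c * v ≤ C` with `c > m / k`, then `m * v < k * C`. -/
theorem mul_lt_of_mul_le {c v C m k : ℝ} (hv : 0 ≤ v) (hC : 0 < C) (hk : 0 < k)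
    (h : c * v ≤ C) (hc : m < k * c) : m * v < k * C := by
  rcases hv.eq_or_lt with rfl | hv
  · rw [mul_zero]; positivity
  · nlinarith

/-- Ranks that a Condorcet winner can have in three or four core voters, the remaining voters
being split into `q` pairs with complementary ranks, such that its score is below average. -/
theorem exists_ranks_weight_lt {n : ℕ} (hm : 3 ≤ m) (hn : 3 ≤ n)
    (ha : ∀ t, t + 1 < m → a (t + 1) ≤ a t) (h0 : 0 ≤ a (m - 1))
    (hpos : 0 < ∑ t ∈ range m, a t) :
    ∃ (c q : ℕ) (s : Fin c → ℕ) (j : ℕ), c + 2 * q = n ∧ 3 ≤ c ∧ c ≤ 4 ∧ ∑ i, s i = m - 1 ∧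
      j ≤ m - 1 ∧ m * (∑ i, a (s i) + q * (a j + a (m - 1 - j)))
        < 2 * (n * ∑ t ∈ range m, a t) := by
  have ha0 : ∀ t < m, 0 ≤ a t := fun t ht => weights_nonneg ha h0 ht
  set T := ∑ t ∈ range m, a t with hT
  have hm0 : (0 : ℝ) < m := by
    have : 0 < m := by omega
    exact_mod_cast this
  obtain ⟨j, hj, hjle⟩ := exists_pair_weight_le ha0 (show m - 1 < m by omega)
  rw [show ((m - 1 : ℕ) : ℝ) + 1 = m by rw [Nat.cast_sub (by omega)]; simp] at hjle
  have combine : ∀ (q : ℕ) (c v : ℝ), 3 ≤ c → c + 2 * q = n → m * v < 2 * c * T →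
      m * (v + q * (a j + a (m - 1 - j))) < 2 * (n * T) := by
    intro q c v hc hcq hv
    have hq : (0 : ℝ) ≤ q := by positivity
    have h1 := mul_le_mul_of_nonneg_left hjle hq
    have h2 : 0 ≤ q * T := by positivity
    rw [← hcq]
    nlinarith
  rcases Nat.even_or_odd n with hev | hodd
  · obtain ⟨q, hq⟩ : ∃ q, 4 + 2 * q = n := by
      obtain ⟨k, hk⟩ := hev
      exact ⟨k - 2, by omega⟩
    -- Four core voters form two pairs with rank sums `m / 2` and `m - 1 - m / 2`, each worth at
    -- most `4 T / m`; rounding makes the first bound strict.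
    obtain ⟨s, hs, hsle⟩ := exists_pair_weight_le ha0 (show m / 2 < m by omega)
    obtain ⟨t, ht, htle⟩ := exists_pair_weight_le ha0 (show m - 1 - m / 2 < m by omega)
    refine ⟨4, q, ![s, m / 2 - s, t, m - 1 - m / 2 - t], j, hq, by norm_num, le_rfl, ?_, hj, ?_⟩
    · simp [Fin.sum_univ_four]
      omega
    · refine combine q 4 _ (by norm_num) (by exact_mod_cast hq) ?_
      have hc1 : (m : ℝ) < 2 * (((m / 2 : ℕ) : ℝ) + 1) := by
        have : m < 2 * (m / 2 + 1) := by omega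
        exact_mod_cast this
      have hc2 : (m : ℝ) ≤ 2 * (((m - 1 - m / 2 : ℕ) : ℝ) + 1) := by
        have : m ≤ 2 * ((m - 1 - m / 2) + 1) := by omega
        exact_mod_cast this
      have hv1 : 0 ≤ a s + a (m / 2 - s) := add_nonneg (ha0 _ (by omega)) (ha0 _ (by omega))
      have hv2 : 0 ≤ a t + a (m - 1 - m / 2 - t) :=
        add_nonneg (ha0 _ (by omega)) (ha0 _ (by omega))
      have h1 := mul_lt_of_mul_le hv1 (by positivity) two_pos hsle hc1
      have h2 := mul_le_mul_of_nonneg_right hc2 hv2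
      simp [Fin.sum_univ_four]
      nlinarith
  · obtain ⟨q, hq⟩ : ∃ q, 3 + 2 * q = n := by
      obtain ⟨k, hk⟩ := hodd
      exact ⟨k - 1, by omega⟩
    -- Three core voters: rank `m / 3` is worth less than `3 T / m`, and a pair with rank sum `m - 1
    -- - m / 3` at most `3 T / m`.
    obtain ⟨s, hs, hsle⟩ := exists_pair_weight_le ha0 (show m - 1 - m / 3 < m by omega)
    have htle := succ_mul_weight_le ha h0 (show m / 3 < m by omega)
    refine ⟨3, q, ![s, m - 1 - m / 3 - s, m / 3], j, hq, le_rfl, by norm_num, ?_, hj, ?_⟩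
    · simp [Fin.sum_univ_three]
      omega
    · refine combine q 3 _ le_rfl (by exact_mod_cast hq) ?_
      have hc1 : (m : ℝ) < 3 * (((m / 3 : ℕ) : ℝ) + 1) := by
        have : m < 3 * (m / 3 + 1) := by omega
        exact_mod_cast this
      have hc2 : 2 * (m : ℝ) ≤ 3 * (((m - 1 - m / 3 : ℕ) : ℝ) + 1) := by
        have : 2 * m ≤ 3 * ((m - 1 - m / 3) + 1) := by omega
        exact_mod_cast this
      have hv1 : 0 ≤ a s + a (m - 1 - m / 3 - s) :=
        add_nonneg (ha0 _ (by omega)) (ha0 _ (by omega))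
      have h1 := mul_lt_of_mul_le (ha0 (m / 3) (by omega)) hpos three_pos htle hc1
      have h2 := mul_le_mul_of_nonneg_right hc2 hv1
      simp [Fin.sum_univ_three]
      nlinarith

end WeightBounds

/-! ### Profiles with a narrow Condorcet winner -/

section CondorcetProfiles

/-- A finite set can be partitioned into parts of prescribed sizes. -/
theorem exists_coloring {α ι : Type*} [Fintype ι] [DecidableEq ι] [Nonempty ι] (T : Finset α) (s : ι → ℕ)
    (h : ∑ i, s i = T.card) :
    ∃ col : α → ι, ∀ i, (T.filter fun a => col a = i).card = s i := by
  have e : {a // a ∈ T} ≃ Σ i, Fin (s i) := Fintype.equivOfCardEq (by simp [h])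
  refine ⟨fun a => if h : a ∈ T then (e ⟨a, h⟩).1 else Classical.arbitrary ι, fun i => ?_⟩
  symm
  rw [← Finset.card_fin (s i)]
  refine Finset.card_bij (fun k _ => (e.symm ⟨i, k⟩).1) ?_ ?_ ?_
  · intro k _
    simp
  · intro k _ k' _ hkk
    have := e.symm.injective (Subtype.ext hkk)
    simpa using this
  · intro a ha
    obtain ⟨haT, hai⟩ := Finset.mem_filter.1 ha
    simp only [dif_pos haT] at hai
    subst hai
    exact ⟨(e ⟨a, haT⟩).2, mem_univ _, by simp⟩

variable {N A : Type*} [Fintype N] [Fintype A]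

/-- A profile in which `x` narrowly beats everything: `c` core voters rank disjoint sets above
`x`, and the other voters form `q` pairs ranking complementary sets above `x`. -/
theorem exists_condorcet_profile (x : A) {c q : ℕ} {s : Fin c → ℕ} {j : ℕ} (hc : 0 < c)
    (hcq : c + 2 * q = Fintype.card N) (hs : ∑ i, s i = Fintype.card A - 1)
    (hj : j ≤ Fintype.card A - 1) :
    ∃ R : Profile N A,
      (∀ g : ℕ → ℝ, ∑ i, g ((R i).upper x).card
        = ∑ i, g (s i) + q * (g j + g (Fintype.card A - 1 - j))) ∧
      ∀ y, y ≠ x → supportingSize R y x = 1 + q := by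
  have hcard : (univ.erase x).card = Fintype.card A - 1 := by
    rw [Finset.card_erase_of_mem (mem_univ _), Finset.card_univ]
  have : Nonempty (Fin c) := ⟨⟨0, hc⟩⟩
  -- The core sets partition the alternatives other than `x`, and so do the two sets of each pair.
  -- Hence every `y` is above `x` for one core voter and one voter per pair.
  obtain ⟨col, hcol⟩ := exists_coloring (univ.erase x) s (by rw [hs, hcard])
  obtain ⟨col', hcol'⟩ := exists_coloring (univ.erase x)
    (fun β : Bool => if β then j else Fintype.card A - 1 - j) (by
      rw [hcard, Fintype.sum_bool]
      simp only [if_true, Bool.false_eq_true, if_false]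
      omega)
  have φ : N ≃ Fin c ⊕ (Fin q × Bool) := Fintype.equivOfCardEq (by simp; omega)
  set P : Fin c ⊕ (Fin q × Bool) → Finset A := Sum.elim
    (fun i => (univ.erase x).filter fun a => col a = i)
    (fun kb => (univ.erase x).filter fun a => col' a = kb.2) with hP
  obtain ⟨R, hR⟩ := exists_profile_upper (N := N) (x := x) (P := fun i => P (φ i)) (by
    intro i
    rcases φ i with v | v <;> simp [hP])
  refine ⟨R, fun g => ?_, fun y hy => ?_⟩
  · simp only [hR]
    rw [Equiv.sum_comp φ fun v => g (P v).card, Fintype.sum_sum_type, Fintype.sum_prod_type]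
    simp [hP, hcol, hcol', mul_add]
  · have h1 : supportingSize R y x = ∑ i, if y ∈ P (φ i) then 1 else 0 := by
      unfold supportingSize
      rw [Finset.card_filter]
      refine Finset.sum_congr rfl fun i _ => ?_
      rw [← hR]
      simp
    rw [h1, Equiv.sum_comp φ fun v => if y ∈ P v then 1 else 0, Fintype.sum_sum_type,
      Fintype.sum_prod_type]
    simp [hP, hy]

end CondorcetProfiles

/-! ### The upper bound and uniqueness -/

section Characterization

variable {N A : Type*} [Fintype N] [Fintype A] {f : SDS N A}

/-- A positive total rank weight makes the bound strict, so equality leaves only the supporting size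
part, which is then determined. -/
theorem le_of_condorcetConsistent_and_unique [Nonempty A] (hN : 3 ≤ Fintype.card N)
    (hA : 3 ≤ Fintype.card A)
    (hf : Strategyproof f) (ha : Anonymous f) (hn : Neutral f) {α : ℝ}
    (hα : CondorcetConsistent α f) :
    α ≤ 2 / Fintype.card A ∧
      (α = 2 / Fintype.card A → f = randomizedCopeland (le_trans (Nat.le_succ 2) hA)) := by
  obtain ⟨a, b, hrep, hanti, h0, hb0, hbmono, hbsymm⟩ :=
    exists_decomposition (by omega) (by omega) hf ha hn
  set n := Fintype.card N with hn_def
  set m := Fintype.card A with hm_def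
  set B := b n with hB
  have hm0 : (0 : ℝ) < m := by
    have : 0 < m := by omega
    exact_mod_cast this
  have hm1 : (0 : ℝ) < (m : ℝ) - 1 := by
    have : (1 : ℝ) < m := by
      have : 1 < m := by omega
      exact_mod_cast this
    linarith
  obtain ⟨x₀⟩ := ‹Nonempty A›
  obtain ⟨r₀, -⟩ := exists_preference_of_level (fun _ : A => 0)
  have hone := sum_weights_eq_one (hrep fun _ => r₀) hbsymm
  have hbmono' : ∀ k l, k ≤ l → l ≤ n → b k ≤ b l := by
    intro k l hkl
    induction l, hkl using Nat.le_induction with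
    | base => intro _; exact le_rfl
    | succ l _ ih => exact fun hl => (ih (by omega)).trans (hbmono l (by omega))
  have ha0 : ∀ t < m, 0 ≤ a t := fun t ht => weights_nonneg hanti h0 ht
  have hbound : ∀ (c q : ℕ) (s : Fin c → ℕ) (j : ℕ), c + 2 * q = n → 3 ≤ c →
      ∑ i, s i = m - 1 → j ≤ m - 1 →
      α ≤ ∑ i, a (s i) + q * (a j + a (m - 1 - j)) + ((m : ℝ) - 1) * b (n - (1 + q)) := by
    intro c q s j hcq hc hs hj
    obtain ⟨R, hR, hRk⟩ := exists_condorcet_profile x₀ (by omega) hcq hs hj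
    have hk : ∀ y, y ≠ x₀ → supportingSize R x₀ y = n - (1 + q) := fun y hy => by
      have := supportingSize_add R hy.symm
      have := hRk y hy
      omega
    have hw : IsCondorcetWinner R x₀ := fun y hy => by
      rw [hk y hy, hRk y hy]
      omega
    have h1 := hα R x₀ hw
    rw [hrep, hR] at h1
    have h2 : ∑ y ∈ univ.erase x₀, b (supportingSize R x₀ y)
        = ((m : ℝ) - 1) * b (n - (1 + q)) := by
      rw [Finset.sum_congr rfl fun y hy => by rw [hk y (Finset.ne_of_mem_erase hy)],
        Finset.sum_const, nsmul_eq_mul, Finset.card_erase_of_mem (mem_univ _), Finset.card_univ,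
        Nat.cast_sub (by omega)]
      simp [hm_def]
    linarith
  by_cases hpos : 0 < ∑ t ∈ range m, a t
  · obtain ⟨c, q, s, j, hcq, hc, -, hs, hj, hlt⟩ := exists_ranks_weight_lt hA hN hanti h0 hpos
    have h1 := hbound c q s j hcq hc hs hj
    have h2 := hbmono' (n - (1 + q)) n (by omega) le_rfl
    have h3 : α < 2 / m := by
      rw [lt_div_iff₀ hm0]
      have h4 := mul_le_mul_of_nonneg_left h2 hm1.le
      have h5 := mul_le_mul_of_nonneg_left (h1.trans (add_le_add_right h4 _)) hm0.le
      rw [← hB] at h5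
      linarith
    exact ⟨h3.le, fun h => absurd h h3.ne⟩
  · have hsum0 : ∑ t ∈ range m, a t = 0 :=
      le_antisymm (not_lt.1 hpos) (Finset.sum_nonneg fun t ht => ha0 t (by simpa using ht))
    have haz : ∀ t < m, a t = 0 := fun t ht =>
      (Finset.sum_eq_zero_iff_of_nonneg (fun t ht => ha0 t (by simpa using ht))).1 hsum0 t
        (by simpa using ht)
    rw [hsum0, mul_zero, zero_add] at hone
    -- Constant weights serve only to obtain admissible counts. Because `3 ≤ c ≤ 4`, the winner's
    -- support `n - (1 + q)` is the smallest strict majority.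
    obtain ⟨c, q, s, j, hcq, hc, hc4, hs, hj, -⟩ := exists_ranks_weight_lt (a := fun _ => 1) hA hN
      (fun _ _ => le_rfl) zero_le_one (by simp; omega)
    have h1 := hbound c q s j hcq hc hs hj
    have h2 := hbmono' (n - (1 + q)) n (by omega) le_rfl
    have hz : ∑ i, a (s i) + q * (a j + a (m - 1 - j)) = 0 := by
      rw [Finset.sum_eq_zero fun i _ => haz _ ?_, haz j (by omega), haz _ (by omega)]
      · ring
      · have := Finset.single_le_sum (f := s) (fun _ _ => Nat.zero_le _) (mem_univ i)
        omega
    rw [hz, zero_add] at h1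
    have h4 := mul_le_mul_of_nonneg_left h2 hm1.le
    have hBval : ((m : ℝ) - 1) * B = 2 / m := by
      rw [eq_div_iff hm0.ne']
      linarith
    refine ⟨by rw [← hBval]; exact h1.trans h4, fun heq => ?_⟩
    have hbB : b (n - (1 + q)) = B := by
      refine le_antisymm h2 ?_
      rw [heq, ← hBval] at h1
      exact le_of_mul_le_mul_left h1 hm1
    have hbig : ∀ k ≤ n, n < 2 * k → b k = B := fun k hk hk2 =>
      le_antisymm (hbmono' k n hk le_rfl) (hbB ▸ hbmono' _ k (by omega) hk)
    funext R
    apply Subtype.ext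
    funext x
    change f R x = copelandScore R x / ∑ y, copelandScore R y
    rw [hrep, Finset.sum_eq_zero fun i _ => haz _ ((R i).card_upper_lt x), zero_add,
      eq_div_iff (sum_copelandScore_pos (by omega) R).ne', sum_copelandScore,
      copelandScore_eq_sum]
    have hterm : ∀ y ∈ univ.erase x, b (supportingSize R x y) = B *
        (if supportingSize R y x < supportingSize R x y then (1 : ℝ)
          else if supportingSize R x y = supportingSize R y x then 1 / 2 else 0) := by
      intro y hy
      have hadd := supportingSize_add R (Finset.ne_of_mem_erase hy).symm
      rw [← hn_def] at hadd
      have hs1 := hbsymm (supportingSize R x y) (by omega)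
      rw [show n - supportingSize R x y = supportingSize R y x by omega] at hs1
      rcases lt_trichotomy (supportingSize R y x) (supportingSize R x y) with h | h | h
      · rw [if_pos h, hbig _ (by omega) (by omega), mul_one]
      · rw [if_neg h.not_lt, if_pos h.symm]
        rw [h] at hs1
        linarith
      · rw [if_neg h.not_gt, if_neg h.ne]
        rw [hbig (supportingSize R y x) (by omega) (by omega)] at hs1
        linarith
    rw [Finset.sum_congr rfl hterm, ← Finset.mul_sum, ← Finset.sum_filter,
      Finset.filter_ne' univ x, ← hm_def]
    linear_combination (∑ y ∈ univ.erase x, (if supportingSize R y x < supportingSize R x y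
      then (1 : ℝ) else if supportingSize R x y = supportingSize R y x then 1 / 2 else 0)) * hone

end Characterization

/-! ### Properties of the randomized Copeland rule -/

section Copeland

variable {N A : Type*} [Fintype N]

/-- The points that `x` gets from the majority comparison with `y`. -/
noncomputable def majorityPoints (R : Profile N A) (x y : A) : ℝ :=
  if supportingSize R y x < supportingSize R x y then 1
    else if supportingSize R x y = supportingSize R y x then 1 / 2 else 0

theorem copelandScore_eq_sum_erase [Fintype A] (R : Profile N A) (x : A) :
    copelandScore R x = ∑ y ∈ univ.erase x, majorityPoints R x y := by
  rw [copelandScore_eq_sum, ← Finset.sum_filter, Finset.filter_ne' univ x]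
  rfl

theorem majorityPoints_add (R : Profile N A) (x y : A) :
    majorityPoints R x y + majorityPoints R y x = 1 := by
  unfold majorityPoints
  rcases lt_trichotomy (supportingSize R y x) (supportingSize R x y) with h | h | h
  · simp [h, h.not_gt, h.ne]
  · simp [h]; norm_num
  · simp [h, h.not_gt, h.ne]

theorem majorityPoints_mono {R R' : Profile N A} {x y : A}
    (h : supportingSize R x y ≤ supportingSize R' x y)
    (h' : supportingSize R' y x ≤ supportingSize R y x) :
    majorityPoints R x y ≤ majorityPoints R' x y := by
  unfold majorityPoints
  split_ifs <;> first | omega | norm_num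

variable [Fintype A]

/-- Each pair inside `W` shares exactly one point whatever the profile, so only comparisons with the
outside vary. -/
theorem sum_copelandScore_subset (R : Profile N A) (W : Finset A) :
    ∑ x ∈ W, copelandScore R x
      = ((W.card : ℝ) * W.card - W.card) / 2 + ∑ x ∈ W, ∑ y ∈ univ \ W, majorityPoints R x y := by
  have h1 : ∀ x ∈ W, copelandScore R x
      = ∑ y ∈ W, majorityPoints R x y - 1 / 2 + ∑ y ∈ univ \ W, majorityPoints R x y := by
    intro x _
    have h2 : majorityPoints R x x = 1 / 2 := by
      have := majorityPoints_add R x x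
      linarith
    rw [copelandScore_eq_sum_erase, Finset.sum_erase_eq_sub (mem_univ x), h2,
      ← Finset.sum_sdiff (Finset.subset_univ W)]
    ring
  rw [Finset.sum_congr rfl h1, Finset.sum_add_distrib, Finset.sum_sub_distrib]
  have h3 : ∑ x ∈ W, ∑ y ∈ W, majorityPoints R x y + ∑ x ∈ W, ∑ y ∈ W, majorityPoints R x y
      = (W.card : ℝ) * W.card := by
    nth_rewrite 2 [Finset.sum_comm]
    simp only [← Finset.sum_add_distrib, majorityPoints_add]
    simp
  simp only [Finset.sum_const, nsmul_eq_mul]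
  linarith

theorem randomizedCopeland_apply (hm : 2 ≤ Fintype.card A) (R : Profile N A) (x : A) :
    randomizedCopeland hm R x
      = copelandScore R x / ((Fintype.card A : ℝ) * ((Fintype.card A : ℝ) - 1) / 2) := by
  rw [← sum_copelandScore R]
  rfl

/-- For an upper contour set `W`, truth already supports every member of `W` against every outsider,
so a misreport cannot raise the points `W` takes from outside. -/
theorem strategyproof_randomizedCopeland (hm : 2 ≤ Fintype.card A) :
    Strategyproof (randomizedCopeland hm : SDS N A) := by
  intro R R' i hR x
  simp only [randomizedCopeland_apply, ← Finset.sum_div]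
  have hpos := sum_copelandScore_pos hm R
  rw [sum_copelandScore] at hpos
  refine div_le_div_of_nonneg_right ?_ hpos.le
  rw [sum_copelandScore_subset, sum_copelandScore_subset]
  refine add_le_add_right (Finset.sum_le_sum fun y hy => Finset.sum_le_sum fun z hz => ?_) _
  have hyx : (R i).pref y x := by simpa using hy
  have hzx : ¬ (R i).pref z x := by simpa using hz
  have hyz : (R i).pref y z := by
    rcases eq_or_ne z x with rfl | h
    · exact hyx
    · exact (R i).trans _ _ _ hyx (((R i).not_pref_iff h).1 hzx)
  refine majorityPoints_mono (Finset.card_le_card ?_) (Finset.card_le_card ?_)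
  · intro j hj
    simp only [Finset.mem_filter, Finset.mem_univ, true_and] at hj ⊢
    by_cases hji : j = i
    · rwa [hji]
    · rwa [hR j hji]
  · intro j hj
    simp only [Finset.mem_filter, Finset.mem_univ, true_and] at hj ⊢
    by_cases hji : j = i
    · exact absurd (hji ▸ hj) ((R i).asymm hyz)
    · rwa [← hR j hji]

theorem supportingSize_permuteVoters {A : Type*} (R : Profile N A) (π : Equiv.Perm N) (x y : A) :
    supportingSize (Profile.permuteVoters π R) x y = supportingSize R x y := by
  unfold supportingSize Profile.permuteVoters
  simp only [Finset.card_filter]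
  exact Equiv.sum_comp π.symm fun i => if (R i).pref x y then 1 else 0

theorem supportingSize_permuteAlternatives {A : Type*} (R : Profile N A) (τ : Equiv.Perm A)
    (x y : A) :
    supportingSize (Profile.permuteAlternatives τ R) (τ x) (τ y) = supportingSize R x y := by
  simp [supportingSize, Profile.permuteAlternatives, Preference.permute]

theorem anonymous_randomizedCopeland (hm : 2 ≤ Fintype.card A) :
    Anonymous (randomizedCopeland hm : SDS N A) := by
  intro R π
  apply Subtype.ext
  funext x
  change randomizedCopeland hm R x = randomizedCopeland hm (Profile.permuteVoters π R) x
  simp only [randomizedCopeland_apply, copelandScore, supportingSize_permuteVoters]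

theorem neutral_randomizedCopeland (hm : 2 ≤ Fintype.card A) :
    Neutral (randomizedCopeland hm : SDS N A) := by
  intro R τ x
  rw [randomizedCopeland_apply, randomizedCopeland_apply]
  congr 1
  rw [copelandScore_eq_sum, copelandScore_eq_sum]
  conv_rhs => rw [← Equiv.sum_comp τ]
  simp [supportingSize_permuteAlternatives]

theorem condorcetConsistent_randomizedCopeland (hm : 2 ≤ Fintype.card A) :
    CondorcetConsistent (2 / (Fintype.card A : ℝ)) (randomizedCopeland hm : SDS N A) := by
  intro R x hx
  have h2 : (2 : ℝ) ≤ Fintype.card A := by exact_mod_cast hm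
  have h : copelandScore R x = (Fintype.card A : ℝ) - 1 := by
    rw [copelandScore_eq_sum_erase, Finset.sum_congr rfl (g := fun _ => (1 : ℝ)),
      Finset.sum_const, Finset.card_erase_of_mem (mem_univ _), Finset.card_univ, nsmul_eq_mul,
      Nat.cast_sub (by omega)]
    · simp
    · intro y hy
      exact if_pos (hx y (Finset.ne_of_mem_erase hy))
  rw [randomizedCopeland_apply, h]
  have h3 : (Fintype.card A : ℝ) - 1 ≠ 0 := by
    have : (0 : ℝ) < (Fintype.card A : ℝ) - 1 := by linarith
    exact this.ne'
  refine le_of_eq ?_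
  field_simp

end Copeland

/-! ### Averaging over renamings of voters and alternatives -/

section Symmetrization

variable {N A : Type*} [Fintype N] [Fintype A]

/-- The profile in which voters are renamed by `π` and alternatives by `τ`. -/
def Profile.relabel {N A : Type*} (π : Equiv.Perm N) (τ : Equiv.Perm A) (R : Profile N A) :
    Profile N A :=
  fun i => (R (π.symm i)).permute τ

/-- The average of an SDS over all renamings of voters and alternatives. -/
noncomputable def symmetrize (f : SDS N A) : SDS N A := fun R =>
  ⟨fun x => (∑ p : Equiv.Perm N × Equiv.Perm A, f (R.relabel p.1 p.2) (p.2 x))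
      / Fintype.card (Equiv.Perm N × Equiv.Perm A),
    fun x => div_nonneg (Finset.sum_nonneg fun p _ => (f _).2.1 _) (Nat.cast_nonneg _), by
    have h : ∀ p : Equiv.Perm N × Equiv.Perm A, ∑ x, f (R.relabel p.1 p.2) (p.2 x) = 1 :=
      fun p => (Equiv.sum_comp p.2 _).trans (f (R.relabel p.1 p.2)).2.2
    rw [← Finset.sum_div, Finset.sum_comm, Finset.sum_congr rfl fun p _ => h p, Finset.sum_const,
      Finset.card_univ, nsmul_one]
    exact div_self (Nat.cast_ne_zero.2 Fintype.card_ne_zero)⟩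

theorem symmetrize_apply (f : SDS N A) (R : Profile N A) (x : A) :
    symmetrize f R x = (∑ p : Equiv.Perm N × Equiv.Perm A, f (R.relabel p.1 p.2) (p.2 x))
      / Fintype.card (Equiv.Perm N × Equiv.Perm A) := rfl

theorem Strategyproof.symmetrize {f : SDS N A} (hf : Strategyproof f) :
    Strategyproof (symmetrize f) := by
  intro R R' i hR x
  simp only [symmetrize_apply, ← Finset.sum_div]
  refine div_le_div_of_nonneg_right ?_ (Nat.cast_nonneg _)
  rw [Finset.sum_comm, Finset.sum_comm (s := univ.filter fun y => (R i).pref y x)]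
  refine Finset.sum_le_sum fun p _ => ?_
  have key := hf (R.relabel p.1 p.2) (R'.relabel p.1 p.2) (p.1 i) (fun j hj => by
    have : p.1.symm j ≠ i := fun h => hj (by rw [← h]; simp)
    simp [Profile.relabel, hR _ this]) (p.2 x)
  have e : ∀ q : stdSimplex ℝ A,
      ∑ y with (R.relabel p.1 p.2 (p.1 i)).pref y (p.2 x), q y
        = ∑ y with (R i).pref y x, q (p.2 y) := by
    intro q
    simp only [Finset.sum_filter]
    rw [← Equiv.sum_comp p.2]
    simp [Profile.relabel, Preference.permute]
  rw [e, e] at key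
  exact key

theorem anonymous_symmetrize (f : SDS N A) : Anonymous (symmetrize f) := by
  intro R π
  apply Subtype.ext
  funext x
  change symmetrize f R x = symmetrize f (Profile.permuteVoters π R) x
  rw [symmetrize_apply, symmetrize_apply,
    -- Renaming first by `π` merely reindexes the average by right multiplication.
    ← Equiv.sum_comp (Equiv.prodCongr (Equiv.mulRight π) (Equiv.refl (Equiv.Perm A)))]
  congr 1

theorem neutral_symmetrize (f : SDS N A) : Neutral (symmetrize f) := by
  intro R τ x
  rw [symmetrize_apply, symmetrize_apply,
    ← Equiv.sum_comp (Equiv.prodCongr (Equiv.refl (Equiv.Perm N)) (Equiv.mulRight τ))]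
  congr 1

theorem IsCondorcetWinner.relabel {A : Type*} {R : Profile N A} {x : A} (h : IsCondorcetWinner R x)
    (π : Equiv.Perm N) (τ : Equiv.Perm A) : IsCondorcetWinner (R.relabel π τ) (τ x) := by
  intro y hy
  obtain ⟨z, rfl⟩ := τ.surjective y
  have e : R.relabel π τ = Profile.permuteAlternatives τ (Profile.permuteVoters π R) := rfl
  rw [e, supportingSize_permuteAlternatives, supportingSize_permuteAlternatives,
    supportingSize_permuteVoters, supportingSize_permuteVoters]
  exact h z fun hz => hy (by rw [hz])

theorem CondorcetConsistent.symmetrize {f : SDS N A} {α : ℝ} (hf : CondorcetConsistent α f) :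
    CondorcetConsistent α (symmetrize f) := by
  intro R x hx
  rw [symmetrize_apply, le_div_iff₀ (Nat.cast_pos.2 Fintype.card_pos), mul_comm, ← nsmul_eq_mul,
    ← Finset.card_univ]
  exact Finset.card_nsmul_le_sum _ _ _ fun p _ => hf _ _ (hx.relabel p.1 p.2)

end Symmetrization

/-- No strategyproof SDS is `α`-Condorcet-consistent for `α > 2 / m`. -/
theorem CondorcetConsistent.le_two_div {N A : Type*} [Fintype N] [Fintype A] [Nonempty A]
    (hN : 3 ≤ Fintype.card N) {f : SDS N A} (hf : Strategyproof f) {α : ℝ}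
    (hα : CondorcetConsistent α f) : α ≤ 2 / Fintype.card A := by
  by_cases hA : 3 ≤ Fintype.card A
  · exact (le_of_condorcetConsistent_and_unique hN hA hf.symmetrize (anonymous_symmetrize f)
      (neutral_symmetrize f) hα.symmetrize).1
  -- For `m ≤ 2` the bound `2 / m` is at least one, so any profile with a Condorcet winner suffices.
  · obtain ⟨x⟩ := ‹Nonempty A›
    obtain ⟨R, hR⟩ := exists_profile_upper (N := N) (x := x) (P := fun _ => ∅) (by simp)
    have hw : IsCondorcetWinner R x := by
      intro y hy
      have h1 : supportingSize R y x = 0 := by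
        simp [supportingSize, ← Preference.mem_upper, hR]
      have := supportingSize_add R hy
      omega
    have h1 : f R x ≤ 1 := by
      rw [← (f R).2.2]
      exact Finset.single_le_sum (f := fun y => f R y) (fun y _ => (f R).2.1 y) (mem_univ x)
    refine (hα R x hw).trans (h1.trans ?_)
    have hpos : 0 < Fintype.card A := Fintype.card_pos_iff.2 ⟨x⟩
    rw [le_div_iff₀ (by exact_mod_cast hpos), one_mul]
    have : Fintype.card A ≤ 2 := by omega
    exact_mod_cast this

end SocialChoice

/-- The first conjunct is the characterization of the randomized Copeland rule for at least three
voters and three alternatives; the second is the upper bound for at least three voters. -/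
theorem mainTheorem1 {N A : Type*} [Fintype N] [Fintype A] [Nonempty A]
    (hn : 3 ≤ Fintype.card N) :
    (∀ (hm : 3 ≤ Fintype.card A) (f : SocialChoice.SDS N A),
      (SocialChoice.Strategyproof f ∧ SocialChoice.Anonymous f ∧ SocialChoice.Neutral f ∧
        SocialChoice.CondorcetConsistent (2 / (Fintype.card A : ℝ)) f) ↔
      f = SocialChoice.randomizedCopeland (le_trans (Nat.le_succ 2) hm)) ∧
    (∀ (f : SocialChoice.SDS N A), SocialChoice.Strategyproof f →
      ∀ α : ℝ, 2 / (Fintype.card A : ℝ) < α → ¬ SocialChoice.CondorcetConsistent α f) := by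
  refine ⟨fun hm f => ⟨?_, ?_⟩, fun f hf α hα hc => ?_⟩
  · rintro ⟨hf, ha, hneu, hc⟩
    exact (SocialChoice.le_of_condorcetConsistent_and_unique hn hm hf ha hneu hc).2 rfl
  · rintro rfl
    exact ⟨SocialChoice.strategyproof_randomizedCopeland _,
      SocialChoice.anonymous_randomizedCopeland _, SocialChoice.neutral_randomizedCopeland _,
      SocialChoice.condorcetConsistent_randomizedCopeland _⟩
  · exact absurd (hc.le_two_div hn hf) (not_le.2 hα)
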